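/- **Setting.** Let $\mathcal F$ be a set of symbols, each symbol $f$ with an arity $\alpha_f\in\mathbb N$. Terms (up to renaming of bound variables) are given by $t,u ::= s \mid x \mid f \mid [x:t]u \mid t\,u \mid (x:t)u$, where $s\in\{\star,\Box\}$ is a sort, $x$ a variable, $f\in\mathcal F$, $[x:t]u$ an abstraction and $(x:t)u$ a dependent product. A term is algebraic if it is built only from variables and applications $f\,t_1\dots t_n$ with $n=\alpha_f$. A rule is a pair $l\to r$ with $l$ algebraic, $l$ not a variable and $\mathrm{FV}(r)\subseteq\mathrm{FV}(l)$; it is linear if no variable occurs more than once in $l$ and none occurs more than once in $r$. The rewrite relation of a set of rules replaces, at some position (possibly below binders), an instance $l\sigma$ by $r\sigma$; $\beta$ replaces, at some position, $([x:U]v)\,u$ by $v\{x\to u\}$. Let $\mathcal R$ be a set of rules and $\mathcal E$ a symmetric set of rules ($l\to r\in\mathcal E$ iff $r\to l\in\mathcal E$), and also write $\mathcal R$, $\mathcal E$ for their rewrite relations. Let $\sim$ be the reflexive and transitive closure of $\mathcal E$, let ${\rhd}=\beta\cup{\sim}\mathcal R$ (where ${\sim}\mathcal R$ is $\sim$ followed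 by one $\mathcal R$-step), and let ${\to}=\beta\cup\mathcal R\cup\mathcal E$. For a set $X$ of terms, let $X^{\to}$ be the set of all terms reachable from $X$ by finitely many (possibly zero) $\to$-steps. For a relation $S$, call $u,v$ $S$-joinable modulo $\sim$ if there are $u',v'$ with $u\,S^*\,u'\sim v'$ and $v\,S^*\,v'$. **Theorem.** Let $X$ be any set of terms (for example the set of typable terms, or the set of all terms). Assume that 1. $\rhd$ is strongly normalizing on $X$: no infinite $\rhd$-sequence starts from an element of $X$; 2. $\mathcal E$ is linear, that is, all its rules are linear; 3. $\mathcal R$ is locally $\sim$-confluent on $X^{\to}$: if $t\in X^{\to}$, $t\,\mathcal R\,u$ and $t\,\mathcal R\,v$, then $u,v$ are $\mathcal R$-joinable modulo $\sim$; 4. $\mathcal R$ is locally $\sim$-coherent on $X^{\to}$: if $t\in X^{\to}$, $s\,\mathcal E\,t$ and $t\,\mathcal R\,u$, then $s,u$ are $\mathcal R$-joinable modulo $\sim$. Then $\rhd$ is $\sim$-confluent on $\sim$-classes on $X$: if $t\in X$, $t\sim t'$, $t\rhd^*u$ and $t'\rhd^*v$, then there are $u',v'$ with $u\rhd^*u'\sim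 v'$ and $v\rhd^*v'$. -/

import Mathlib

universe u

namespace CAC

/-- The two sorts: `star` (types and propositions) and `box` (predicate types). -/
inductive Srt : Type
  | star
  | box

/-- Terms of the Calculus of Algebraic Constructions over a set `F` of symbols, up to renaming of
bound variables, with de Bruijn indices: `lam A u` is `[x:A]u` and `pi A u` is `(x:A)u`, where the
index `0` of `u` is the bound variable `x`. Loose indices are the free variables. -/
inductive Term (F : Type u) : Type u
  | sort (s : Srt) : Term F
  | var (n : ℕ) : Term F
  | symb (f : F) : Term F
  | lam (A u : Term F) : Term F
  | app (t u : Term F) : Term F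
  | pi (A u : Term F) : Term F

namespace Term

variable {F : Type u}

/-- Renaming of the free variables. -/
def rename : (ℕ → ℕ) → Term F → Term F
  | _, sort s => sort s
  | ρ, var n => var (ρ n)
  | _, symb f => symb f
  | ρ, lam A u => lam (rename ρ A) (rename (fun n => Nat.casesOn n 0 fun k => ρ k + 1) u)
  | ρ, app t u => app (rename ρ t) (rename ρ u)
  | ρ, pi A u => pi (rename ρ A) (rename (fun n => Nat.casesOn n 0 fun k => ρ k + 1) u)

/-- The substitution `σ` carried below a binder. -/
def up (σ : ℕ → Term F) : ℕ → Term F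
  | 0 => var 0
  | n + 1 => rename Nat.succ (σ n)

/-- Simultaneous capture-avoiding substitution `tσ`. -/
def subst : (ℕ → Term F) → Term F → Term F
  | _, sort s => sort s
  | σ, var n => σ n
  | _, symb f => symb f
  | σ, lam A u => lam (subst σ A) (subst (up σ) u)
  | σ, app t u => app (subst σ t) (subst σ u)
  | σ, pi A u => pi (subst σ A) (subst (up σ) u)

/-- `v.inst a` is `v{x → a}`, where `x` is the variable of index `0`; the binder of `x` disappears,
so the other indices go down by one. -/
def inst (v a : Term F) : Term F :=
  subst (fun n => Nat.casesOn n a fun k => var k) v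

/-- Number of free occurrences of the variable `x` in a term. -/
def occ : ℕ → Term F → ℕ
  | _, sort _ => 0
  | x, var n => if n = x then 1 else 0
  | _, symb _ => 0
  | x, lam A u => occ x A + occ (x + 1) u
  | x, app t u => occ x t + occ x u
  | x, pi A u => occ x A + occ (x + 1) u

/-- The set of free variables of a term. -/
def FV (t : Term F) : Set ℕ := {x | 0 < occ x t}

/-- The algebraic terms: those built only from variables and applications `f t₁ … tₙ` of a symbol
`f` to exactly `n = arity f` arguments. -/
inductive IsAlgebraic (arity : F → ℕ) : Term F → Prop
  | var (n : ℕ) : IsAlgebraic arity (var n)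
  | symb (f : F) (ts : List (Term F)) (hlen : ts.length = arity f)
      (hts : ∀ t ∈ ts, IsAlgebraic arity t) : IsAlgebraic arity (ts.foldl app (symb f))

/-- No variable occurs more than once. -/
def IsLinear (t : Term F) : Prop := ∀ x, occ x t ≤ 1

end Term

/-- A pair `lhs → rhs` of terms. -/
structure Rule (F : Type u) : Type u where
  lhs : Term F
  rhs : Term F

namespace Rule

variable {F : Type u}

/-- `l → r` is a rewrite rule: `l` is algebraic, `l` is not a variable, `FV(r) ⊆ FV(l)`. -/
structure IsRewriteRule (arity : F → ℕ) (ρ : Rule F) : Prop where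
  algebraic : ρ.lhs.IsAlgebraic arity
  not_var : ∀ n, ρ.lhs ≠ Term.var n
  fv_subset : ρ.rhs.FV ⊆ ρ.lhs.FV

/-- A rule is linear if it is both left-linear and right-linear. -/
def IsLinear (ρ : Rule F) : Prop := ρ.lhs.IsLinear ∧ ρ.rhs.IsLinear

end Rule

/-- A set of rewrite rules. -/
def IsRuleSet {F : Type u} (arity : F → ℕ) (R : Set (Rule F)) : Prop :=
  ∀ ρ ∈ R, ρ.IsRewriteRule arity

/-- A set of equations: a symmetric set of rewrite rules. -/
def IsEquationSet {F : Type u} (arity : F → ℕ) (E : Set (Rule F)) : Prop :=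
  IsRuleSet arity E ∧ ∀ l r : Term F, (⟨l, r⟩ : Rule F) ∈ E ↔ (⟨r, l⟩ : Rule F) ∈ E

section Reduction

variable {F : Type u}

/-- `Somewhere H t t'`: the term `t'` is obtained from `t` by replacing the subterm at one position
(possibly below binders) according to the relation `H`. -/
inductive Somewhere (H : Term F → Term F → Prop) : Term F → Term F → Prop
  | here {t t' : Term F} : H t t' → Somewhere H t t'
  | lamDom {A A' u : Term F} : Somewhere H A A' → Somewhere H (.lam A u) (.lam A' u)
  | lamBody {A u u' : Term F} : Somewhere H u u' → Somewhere H (.lam A u) (.lam A u')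
  | appFun {t t' u : Term F} : Somewhere H t t' → Somewhere H (.app t u) (.app t' u)
  | appArg {t u u' : Term F} : Somewhere H u u' → Somewhere H (.app t u) (.app t u')
  | piDom {A A' u : Term F} : Somewhere H A A' → Somewhere H (.pi A u) (.pi A' u)
  | piBody {A u u' : Term F} : Somewhere H u u' → Somewhere H (.pi A u) (.pi A u')

/-- A `β`-redex `([x:U]v) u` and its contractum `v{x → u}`. -/
inductive BetaRedex : Term F → Term F → Prop
  | mk (U v u : Term F) : BetaRedex (.app (.lam U v) u) (v.inst u)

/-- The `β`-rewrite relation. -/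
def Beta : Term F → Term F → Prop := Somewhere BetaRedex

/-- An instance `lσ`, `rσ` of a rule of `R`. -/
inductive RuleInstance (R : Set (Rule F)) : Term F → Term F → Prop
  | mk (ρ : Rule F) (hρ : ρ ∈ R) (σ : ℕ → Term F) :
      RuleInstance R (ρ.lhs.subst σ) (ρ.rhs.subst σ)

/-- The rewrite relation of a set of rules. -/
def Rew (R : Set (Rule F)) : Term F → Term F → Prop := Somewhere (RuleInstance R)

/-- `∼`: the reflexive and transitive closure of the rewrite relation of `E`. -/
def Sim (E : Set (Rule F)) : Term F → Term F → Prop := Relation.ReflTransGen (Rew E)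

/-- `▷`: the union of `β` and of `∼` followed by one `R`-step. -/
def Red (R E : Set (Rule F)) (t u : Term F) : Prop :=
  Beta t u ∨ ∃ s, Sim E t s ∧ Rew R s u

/-- `→`: the union of the rewrite relations of `β`, `R` and `E`. -/
def Arrow (R E : Set (Rule F)) (t u : Term F) : Prop := Beta t u ∨ Rew R t u ∨ Rew E t u

/-- The terms reachable from the set `X` by finitely many (possibly zero) `→`-steps. -/
def Reach (R E : Set (Rule F)) (X : Set (Term F)) : Set (Term F) :=
  {u | ∃ t ∈ X, Relation.ReflTransGen (Arrow R E) t u}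

end Reduction

section Abstract

/-! Properties of a relation `r` modulo `sim` on a type `T`, each of them at the terms of a set `X`;
for `X = Set.univ` they are the unrestricted properties. -/

variable {T : Type u}

/-- No infinite `r`-sequence starts from an element of `X`. -/
def StronglyNormalizingOn (X : Set T) (r : T → T → Prop) : Prop :=
  ∀ t ∈ X, Acc (fun a b => r b a) t

/-- `u` and `v` are related by `r*`, followed by `sim`, followed by the inverse of `r*`. -/
def JoinableModulo (sim r : T → T → Prop) (u v : T) : Prop :=
  ∃ u' v', Relation.ReflTransGen r u u' ∧ sim u' v' ∧ Relation.ReflTransGen r v v'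

/-- Local confluence modulo `sim`, for the peaks `u ← t → v` with `t ∈ X`. -/
def LocallyConfluentModuloOn (X : Set T) (sim r : T → T → Prop) : Prop :=
  ∀ t ∈ X, ∀ u v, r t u → r t v → JoinableModulo sim r u v

/-- Local coherence modulo the reflexive transitive closure of `e`, for the configurations
`s -e- t → u` with `t ∈ X`: one `e`-step followed by one `r`-step. -/
def LocallyCoherentModuloOn (X : Set T) (e r : T → T → Prop) : Prop :=
  ∀ t ∈ X, ∀ s u, e s t → r t u → JoinableModulo (Relation.ReflTransGen e) r s u

/-- Confluence modulo `sim` on `sim`-classes, for the configurations `u *← t sim t' →* v`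
with `t ∈ X`. -/
def ConfluentOnClassesOn (X : Set T) (sim r : T → T → Prop) : Prop :=
  ∀ t ∈ X, ∀ t' u v, sim t t' → Relation.ReflTransGen r t u → Relation.ReflTransGen r t' v →
    JoinableModulo sim r u v

end Abstract

end CAC

namespace CAC

open Relation

variable {F : Type u}

namespace Term

/-! ### Substitution calculus -/

/-! This is Newman's lemma modulo `∼`. The crux is strong coherence (`sim_red_commute`): if `t ∼ s`
and `t ▷ u`, a single step from `s` reaches the class of `u`. For `∼R` this is absorption by
symmetry of `∼`. For `β` it is where linearity enters (`rew_beta_commute`): a `β`-step inside an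
algebraic left-hand side lies in the term put for a variable, and that variable occurs exactly once
on both sides of the equation, so the step is neither copied nor erased.

Hence termination passes to whole `∼`-classes (`acc_of_sim`), and well-founded induction reduces
confluence on classes to local peaks from one term (`joinableModulo_of_acc`). Peaks involving `β`
close without hypotheses on critical pairs (`beta_locally_confluent`, `beta_simRew_joinable`). Peaks
between two `∼R`-steps (`rew_rew_joinable`) are closed by walking along the equational path with
local coherence until local confluence applies; termination guarantees that each coherence diagram
has a genuine `R`-step on the equational side. -/

theorem up_var_comp (ρ : ℕ → ℕ) :
    up (fun n => (var (ρ n) : Term F)) =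
      fun n => var (Nat.casesOn n 0 fun k => ρ k + 1) := by
  funext n
  cases n <;> rfl

theorem rename_eq_subst (t : Term F) (ρ : ℕ → ℕ) :
    rename ρ t = subst (fun n => var (ρ n)) t := by
  induction t generalizing ρ with
  | sort s => rfl
  | var n => rfl
  | symb f => rfl
  | lam A u ihA ihu => simp only [rename, subst, ihA, ihu, up_var_comp]
  | app t u iht ihu => simp only [rename, subst, iht, ihu]
  | pi A u ihA ihu => simp only [rename, subst, ihA, ihu, up_var_comp]

theorem subst_rename (t : Term F) (ρ : ℕ → ℕ) (σ : ℕ → Term F) :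
    subst σ (rename ρ t) = subst (fun n => σ (ρ n)) t := by
  have hup : ∀ (ρ : ℕ → ℕ) (σ : ℕ → Term F),
      (fun n => up σ (Nat.casesOn n 0 fun k => ρ k + 1)) = up fun n => σ (ρ n) := by
    intro ρ σ
    funext n
    cases n <;> rfl
  induction t generalizing ρ σ with
  | sort s => rfl
  | var n => rfl
  | symb f => rfl
  | lam A u ihA ihu => simp only [rename, subst, ihA, ihu, hup]
  | app t u iht ihu => simp only [rename, subst, iht, ihu]
  | pi A u ihA ihu => simp only [rename, subst, ihA, ihu, hup]

theorem rename_rename (t : Term F) (ρ ρ' : ℕ → ℕ) :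
    rename ρ' (rename ρ t) = rename (fun n => ρ' (ρ n)) t := by
  rw [rename_eq_subst _ ρ', subst_rename, rename_eq_subst]

theorem rename_subst (t : Term F) (ρ : ℕ → ℕ) (σ : ℕ → Term F) :
    rename ρ (subst σ t) = subst (fun n => rename ρ (σ n)) t := by
  have hup : ∀ (ρ : ℕ → ℕ) (σ : ℕ → Term F),
      (fun n => rename (fun n => Nat.casesOn n 0 fun k => ρ k + 1) (up σ n)) =
        up fun n => rename ρ (σ n) := by
    intro ρ σ
    funext n
    cases n with
    | zero => rfl
    | succ n => simp only [up, rename_rename]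
  induction t generalizing ρ σ with
  | sort s => rfl
  | var n => rfl
  | symb f => rfl
  | lam A u ihA ihu => simp only [rename, subst, ihA, ihu, hup]
  | app t u iht ihu => simp only [rename, subst, iht, ihu]
  | pi A u ihA ihu => simp only [rename, subst, ihA, ihu, hup]

theorem subst_subst (t : Term F) (σ τ : ℕ → Term F) :
    subst τ (subst σ t) = subst (fun n => subst τ (σ n)) t := by
  have hup : ∀ σ τ : ℕ → Term F,
      (fun n => subst (up τ) (up σ n)) = up fun n => subst τ (σ n) := by
    intro σ τ
    funext n
    cases n with
    | zero => rfl
    | succ n => simp only [up, subst_rename, rename_subst]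
  induction t generalizing σ τ with
  | sort s => rfl
  | var n => rfl
  | symb f => rfl
  | lam A u ihA ihu => simp only [subst, ihA, ihu, hup]
  | app t u iht ihu => simp only [subst, iht, ihu]
  | pi A u ihA ihu => simp only [subst, ihA, ihu, hup]

theorem subst_var (t : Term F) : subst var t = t := by
  have hup : up (var : ℕ → Term F) = var := by
    funext n
    cases n <;> rfl
  induction t with
  | sort s => rfl
  | var n => rfl
  | symb f => rfl
  | lam A u ihA ihu => simp only [subst, ihA, ihu, hup]
  | app t u iht ihu => simp only [subst, iht, ihu]
  | pi A u ihA ihu => simp only [subst, ihA, ihu, hup]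

theorem subst_inst (v u : Term F) (σ : ℕ → Term F) :
    (v.inst u).subst σ = (v.subst (up σ)).inst (u.subst σ) := by
  simp only [inst, subst_subst]
  congr 1
  funext n
  cases n with
  | zero => rfl
  | succ n => simp only [up, subst, subst_rename, subst_var]

/-- Substitutions that agree on the variables of a term act on it in the same way. -/
theorem subst_congr_of_occ {t : Term F} {σ τ : ℕ → Term F}
    (h : ∀ x, 0 < occ x t → σ x = τ x) : t.subst σ = t.subst τ := by
  have hup : ∀ {u : Term F} {σ τ : ℕ → Term F}, (∀ x, 0 < occ (x + 1) u → σ x = τ x) →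
      ∀ x, 0 < occ x u → up σ x = up τ x := by
    intro u σ τ h x hx
    cases x with
    | zero => rfl
    | succ x => simp only [up, h x hx]
  induction t generalizing σ τ with
  | sort s => rfl
  | var n => exact h n (by simp [occ])
  | symb f => rfl
  | lam A u ihA ihu =>
    simp only [occ] at h
    simp only [subst]
    rw [ihA fun x hx => h x (by omega), ihu (hup fun x hx => h x (by omega))]
  | app t u iht ihu =>
    simp only [occ] at h
    simp only [subst]
    rw [iht fun x hx => h x (by omega), ihu fun x hx => h x (by omega)]
  | pi A u ihA ihu =>
    simp only [occ] at h
    simp only [subst]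
    rw [ihA fun x hx => h x (by omega), ihu (hup fun x hx => h x (by omega))]

theorem subst_update_of_occ_eq_zero {t : Term F} {x : ℕ} (h : occ x t = 0) (σ : ℕ → Term F)
    (a : Term F) : t.subst (Function.update σ x a) = t.subst σ :=
  subst_congr_of_occ fun y hy => Function.update_of_ne (by rintro rfl; omega) _ _

theorem up_update (σ : ℕ → Term F) (x : ℕ) (a : Term F) :
    up (Function.update σ x a) = Function.update (up σ) (x + 1) (rename Nat.succ a) := by
  funext n
  cases n with
  | zero => simp [up]
  | succ n =>
    by_cases h : n = x
    · subst h; simp [up]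
    · simp [up, h]

/-- First-order terms: sorts and binders do not occur, and variables are not applied. -/
inductive IsFirstOrder : Term F → Prop
  | var (n : ℕ) : IsFirstOrder (var n)
  | symb (f : F) : IsFirstOrder (symb f)
  | app {t u : Term F} (hv : ∀ n, t ≠ var n) (ht : IsFirstOrder t) (hu : IsFirstOrder u) :
      IsFirstOrder (app t u)

theorem IsFirstOrder.foldl_app {ts : List (Term F)} (hts : ∀ t ∈ ts, IsFirstOrder t)
    {h : Term F} (hh : IsFirstOrder h) (hv : ∀ n, h ≠ Term.var n) :
    IsFirstOrder (ts.foldl Term.app h) := by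
  induction ts generalizing h with
  | nil => exact hh
  | cons t ts ih =>
    exact ih (fun t' ht' => hts t' (by simp [ht'])) (.app hv hh (hts t (by simp)))
      fun n h => by cases h

theorem IsAlgebraic.isFirstOrder {arity : F → ℕ} {t : Term F} (h : IsAlgebraic arity t) :
    IsFirstOrder t := by
  induction h with
  | var n => exact .var n
  | symb f ts _ _ ih => exact .foldl_app ih (.symb f) fun n h => by cases h

/-- The head constructor survives substitution. This rules out overlaps between `β` and left-hand
sides. -/
theorem IsFirstOrder.subst_ne_lam {t : Term F} (h : IsFirstOrder t) (hv : ∀ n, t ≠ Term.var n)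
    (σ : ℕ → Term F) (A u : Term F) : t.subst σ ≠ Term.lam A u := by
  cases h with
  | var n => exact absurd rfl (hv n)
  | symb f => exact fun h => by cases h
  | app _ _ _ => exact fun h => by cases h

end Term

/-! ### Congruence-closed relations -/

/-- A relation on terms that is closed under replacement of one immediate subterm. -/
structure IsCompatible (J : Term F → Term F → Prop) : Prop where
  lamDom {A A'} (u) : J A A' → J (.lam A u) (.lam A' u)
  lamBody (A) {u u'} : J u u' → J (.lam A u) (.lam A u')
  appFun {t t'} (u) : J t t' → J (.app t u) (.app t' u)
  appArg (t) {u u'} : J u u' → J (.app t u) (.app t u')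
  piDom {A A'} (u) : J A A' → J (.pi A u) (.pi A' u)
  piBody (A) {u u'} : J u u' → J (.pi A u) (.pi A u')

theorem isCompatible_somewhere (H : Term F → Term F → Prop) : IsCompatible (Somewhere H) where
  lamDom _ h := .lamDom h
  lamBody _ _ _ h := .lamBody h
  appFun _ h := .appFun h
  appArg _ _ _ h := .appArg h
  piDom _ h := .piDom h
  piBody _ _ _ h := .piBody h

theorem IsCompatible.reflTransGen {J : Term F → Term F → Prop} (hJ : IsCompatible J) :
    IsCompatible (ReflTransGen J) where
  lamDom u h := ReflTransGen.lift (fun A => Term.lam A u) (fun _ _ => hJ.lamDom u) _ _ h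
  lamBody A _ _ h := ReflTransGen.lift (Term.lam A) (fun _ _ => hJ.lamBody A) _ _ h
  appFun u h := ReflTransGen.lift (fun t => Term.app t u) (fun _ _ => hJ.appFun u) _ _ h
  appArg t _ _ h := ReflTransGen.lift (Term.app t) (fun _ _ => hJ.appArg t) _ _ h
  piDom u h := ReflTransGen.lift (fun A => Term.pi A u) (fun _ _ => hJ.piDom u) _ _ h
  piBody A _ _ h := ReflTransGen.lift (Term.pi A) (fun _ _ => hJ.piBody A) _ _ h

theorem IsCompatible.join {J K : Term F → Term F → Prop} (hJ : IsCompatible J)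
    (hK : IsCompatible K) : IsCompatible fun s u => ∃ w, J s w ∧ K u w where
  lamDom u := fun ⟨_, h, k⟩ => ⟨_, hJ.lamDom u h, hK.lamDom u k⟩
  lamBody A _ _ := fun ⟨_, h, k⟩ => ⟨_, hJ.lamBody A h, hK.lamBody A k⟩
  appFun u := fun ⟨_, h, k⟩ => ⟨_, hJ.appFun u h, hK.appFun u k⟩
  appArg t _ _ := fun ⟨_, h, k⟩ => ⟨_, hJ.appArg t h, hK.appArg t k⟩
  piDom u := fun ⟨_, h, k⟩ => ⟨_, hJ.piDom u h, hK.piDom u k⟩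
  piBody A _ _ := fun ⟨_, h, k⟩ => ⟨_, hJ.piBody A h, hK.piBody A k⟩

theorem Somewhere.mono {H K : Term F → Term F → Prop} (hHK : ∀ t u, H t u → K t u)
    {t u : Term F} (h : Somewhere H t u) : Somewhere K t u := by
  induction h with
  | here h => exact .here (hHK _ _ h)
  | lamDom _ ih => exact .lamDom ih
  | lamBody _ ih => exact .lamBody ih
  | appFun _ ih => exact .appFun ih
  | appArg _ ih => exact .appArg ih
  | piDom _ ih => exact .piDom ih
  | piBody _ ih => exact .piBody ih

/-- A relation on terms that is stable under substitution. -/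
def IsSubstStable (H : Term F → Term F → Prop) : Prop :=
  ∀ ⦃t u⦄, H t u → ∀ σ, H (t.subst σ) (u.subst σ)

theorem isSubstStable_betaRedex : IsSubstStable (BetaRedex (F := F)) := by
  rintro _ _ ⟨U, v, u⟩ σ
  rw [Term.subst_inst]
  exact .mk _ _ _

theorem isSubstStable_ruleInstance (R : Set (Rule F)) : IsSubstStable (RuleInstance R) := by
  rintro _ _ ⟨ρ, hρ, τ⟩ σ
  rw [Term.subst_subst, Term.subst_subst]
  exact .mk ρ hρ _

theorem IsSubstStable.somewhere {H : Term F → Term F → Prop} (hH : IsSubstStable H) :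
    IsSubstStable (Somewhere H) := by
  intro t u h
  induction h with
  | here h => exact fun σ => .here (hH h σ)
  | lamDom _ ih => exact fun σ => .lamDom (ih σ)
  | lamBody _ ih => exact fun σ => .lamBody (ih _)
  | appFun _ ih => exact fun σ => .appFun (ih σ)
  | appArg _ ih => exact fun σ => .appArg (ih σ)
  | piDom _ ih => exact fun σ => .piDom (ih σ)
  | piBody _ ih => exact fun σ => .piBody (ih _)

theorem IsSubstStable.rename {H : Term F → Term F → Prop} (hH : IsSubstStable H) {t u : Term F}
    (h : H t u) (ρ : ℕ → ℕ) : H (t.rename ρ) (u.rename ρ) := by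
  rw [Term.rename_eq_subst, Term.rename_eq_subst]
  exact hH h _

theorem IsSubstStable.reflTransGen {H : Term F → Term F → Prop} (hH : IsSubstStable H) :
    IsSubstStable (ReflTransGen H) :=
  fun _ _ h σ => ReflTransGen.lift (Term.subst σ) (fun _ _ h => hH h σ) _ _ h

/-- Reducing the terms put for the variables reduces an instance. -/
theorem reflTransGen_subst {H : Term F → Term F → Prop} (hc : IsCompatible H)
    (hs : IsSubstStable H) (t : Term F) {σ τ : ℕ → Term F}
    (h : ∀ x, ReflTransGen H (σ x) (τ x)) : ReflTransGen H (t.subst σ) (t.subst τ) := by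
  have hup : ∀ {σ τ : ℕ → Term F}, (∀ x, ReflTransGen H (σ x) (τ x)) →
      ∀ x, ReflTransGen H (Term.up σ x) (Term.up τ x) := by
    intro σ τ h x
    cases x with
    | zero => exact .refl
    | succ x => exact hs.reflTransGen.rename (h x) _
  induction t generalizing σ τ with
  | sort s => exact .refl
  | var n => exact h n
  | symb f => exact .refl
  | lam A u ihA ihu =>
    exact (hc.reflTransGen.lamDom _ (ihA h)).trans (hc.reflTransGen.lamBody _ (ihu (hup h)))
  | app t u iht ihu =>
    exact (hc.reflTransGen.appFun _ (iht h)).trans (hc.reflTransGen.appArg _ (ihu h))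
  | pi A u ihA ihu =>
    exact (hc.reflTransGen.piDom _ (ihA h)).trans (hc.reflTransGen.piBody _ (ihu (hup h)))

theorem reflTransGen_subst_update {H : Term F → Term F → Prop} (hc : IsCompatible H)
    (hs : IsSubstStable H) (t : Term F) {σ : ℕ → Term F} {x : ℕ} {a : Term F}
    (h : H (σ x) a) : ReflTransGen H (t.subst σ) (t.subst (Function.update σ x a)) := by
  refine reflTransGen_subst hc hs t fun y => ?_
  by_cases hy : y = x
  · subst hy
    simpa using ReflTransGen.single h
  · simpa [hy] using ReflTransGen.refl

/-- Reducing the term put for a variable that occurs once reduces an instance in one step. -/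
theorem subst_update_of_occ_eq_one {H : Term F → Term F → Prop} (hc : IsCompatible H)
    (hs : IsSubstStable H) (t : Term F) {σ : ℕ → Term F} {x : ℕ} {a : Term F}
    (h : H (σ x) a) (hx : t.occ x = 1) :
    H (t.subst σ) (t.subst (Function.update σ x a)) := by
  induction t generalizing σ x a with
  | sort s => simp [Term.occ] at hx
  | var n =>
    obtain rfl : n = x := by simpa [Term.occ] using hx
    simpa [Term.subst] using h
  | symb f => simp [Term.occ] at hx
  | lam A u ihA ihu =>
    simp only [Term.occ] at hx
    simp only [Term.subst, Term.up_update]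
    rcases (by omega : A.occ x = 1 ∧ u.occ (x + 1) = 0 ∨ A.occ x = 0 ∧ u.occ (x + 1) = 1) with
      ⟨h1, h0⟩ | ⟨h0, h1⟩
    · rw [Term.subst_update_of_occ_eq_zero h0]
      exact hc.lamDom _ (ihA h h1)
    · rw [Term.subst_update_of_occ_eq_zero h0]
      exact hc.lamBody _ (ihu (hs.rename h _) h1)
  | app t u iht ihu =>
    simp only [Term.occ] at hx
    simp only [Term.subst]
    rcases (by omega : t.occ x = 1 ∧ u.occ x = 0 ∨ t.occ x = 0 ∧ u.occ x = 1) with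
      ⟨h1, h0⟩ | ⟨h0, h1⟩
    · rw [Term.subst_update_of_occ_eq_zero h0]
      exact hc.appFun _ (iht h h1)
    · rw [Term.subst_update_of_occ_eq_zero h0]
      exact hc.appArg _ (ihu h h1)
  | pi A u ihA ihu =>
    simp only [Term.occ] at hx
    simp only [Term.subst, Term.up_update]
    rcases (by omega : A.occ x = 1 ∧ u.occ (x + 1) = 0 ∨ A.occ x = 0 ∧ u.occ (x + 1) = 1) with
      ⟨h1, h0⟩ | ⟨h0, h1⟩
    · rw [Term.subst_update_of_occ_eq_zero h0]
      exact hc.piDom _ (ihA h h1)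
    · rw [Term.subst_update_of_occ_eq_zero h0]
      exact hc.piBody _ (ihu (hs.rename h _) h1)

/-! ### Peaks between `β` and a rewrite relation -/

/-- A `β`-step in an instance of a first-order term happens in the term put for one of its
variables; the other occurrences of that variable can be reduced likewise. -/
theorem beta_subst_of_isFirstOrder {l : Term F} (hl : l.IsFirstOrder) {σ : ℕ → Term F}
    {u : Term F} (h : Beta (l.subst σ) u) :
    ∃ x a, x ∈ l.FV ∧ Beta (σ x) a ∧
      ReflTransGen Beta u (l.subst (Function.update σ x a)) ∧
      (l.IsLinear → u = l.subst (Function.update σ x a)) := by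
  have hc := isCompatible_somewhere (BetaRedex (F := F))
  have hs := (isSubstStable_betaRedex (F := F)).somewhere
  induction hl generalizing u with
  | var n =>
    refine ⟨n, u, ?_, h, ?_, ?_⟩ <;> simp [Term.FV, Term.occ, Term.subst, ReflTransGen.refl]
  | symb f =>
    generalize hw : (Term.symb f).subst σ = w at h
    cases h with
    | here h => cases h; simp [Term.subst] at hw
    | _ => simp [Term.subst] at hw
  | @app t v hv ht _ iht ihv =>
    generalize hw : (Term.app t v).subst σ = w at h
    cases h with
    -- A root redex would make the instance of `t` an abstraction, but `t` is not a variable.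
    | here h =>
      cases h
      simp only [Term.subst, Term.app.injEq] at hw
      exact absurd hw.1 (ht.subst_ne_lam hv _ _ _)
    | appFun h =>
      simp only [Term.subst, Term.app.injEq] at hw
      obtain ⟨rfl, rfl⟩ := hw
      obtain ⟨x, a, hx, ha, hr, hlin⟩ := iht h
      -- `hr` catches up inside `t`; the occurrences of `x` in `v` still have to be reduced, and
      -- there are none if the term is linear.
      refine ⟨x, a, Nat.lt_of_lt_of_le hx (Nat.le_add_right _ _), ha,
        (hc.reflTransGen.appFun _ hr).trans
          (hc.reflTransGen.appArg _ (reflTransGen_subst_update hc hs v ha)), fun hlv => ?_⟩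
      have hx0 : v.occ x = 0 := by
        have := hlv x
        simp only [Term.FV, Set.mem_ofPred_eq] at hx
        simp only [Term.occ] at this
        omega
      rw [hlin fun y => (Nat.le_add_right _ _).trans (hlv y), Term.subst,
        Term.subst_update_of_occ_eq_zero hx0]
    | appArg h =>
      simp only [Term.subst, Term.app.injEq] at hw
      obtain ⟨rfl, rfl⟩ := hw
      obtain ⟨x, a, hx, ha, hr, hlin⟩ := ihv h
      refine ⟨x, a, Nat.lt_of_lt_of_le hx (Nat.le_add_left _ _), ha,
        (hc.reflTransGen.appArg _ hr).trans
          (hc.reflTransGen.appFun _ (reflTransGen_subst_update hc hs t ha)), fun hlv => ?_⟩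
      have hx0 : t.occ x = 0 := by
        have := hlv x
        simp only [Term.FV, Set.mem_ofPred_eq] at hx
        simp only [Term.occ] at this
        omega
      rw [hlin fun y => (Nat.le_add_left _ _).trans (hlv y), Term.subst,
        Term.subst_update_of_occ_eq_zero hx0]
    | lamDom _ => simp [Term.subst] at hw
    | lamBody _ => simp [Term.subst] at hw
    | piDom _ => simp [Term.subst] at hw
    | piBody _ => simp [Term.subst] at hw

/-- The peaks between `β` and a rewrite relation are in a compatible relation `J` as soon as the
peaks with a rewrite step at the root and those closed by one `β`-step are. -/
theorem peak_of_root {K J : Term F → Term F → Prop} (hK : IsSubstStable K)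
    (hlam : ∀ A u s, ¬ K (.lam A u) s) (hJ : IsCompatible J)
    (hroot : ∀ t s u, K t s → Beta t u → J s u)
    (hclose : ∀ s u w, Beta s w → ReflTransGen (Somewhere K) u w → J s u)
    {t s u : Term F} (hts : Somewhere K t s) (htu : Beta t u) : J s u := by
  induction hts generalizing u with
  | here h => exact hroot _ _ _ h htu
  | lamDom h ih =>
    cases htu with
    | here h => cases h
    | lamDom h' => exact hJ.lamDom _ (ih h')
    | lamBody h' => exact hclose _ _ _ (.lamBody h') (.single (.lamDom h))
  | lamBody h ih =>
    cases htu with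
    | here h => cases h
    | lamDom h' => exact hclose _ _ _ (.lamDom h') (.single (.lamBody h))
    | lamBody h' => exact hJ.lamBody _ (ih h')
  | appFun h ih =>
    cases htu with
    | here h' =>
      obtain ⟨U, v, a⟩ := h'
      -- The `K`-step is inside the contracted abstraction: in its type it is erased, in its body it
      -- survives by stability.
      cases h with
      | here h => exact absurd h (hlam _ _ _)
      | lamDom h => exact hclose _ _ _ (.here (.mk _ _ _)) .refl
      | lamBody h => exact hclose _ _ _ (.here (.mk _ _ _)) (.single (hK.somewhere h _))
    | appFun h' => exact hJ.appFun _ (ih h')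
    | appArg h' => exact hclose _ _ _ (.appArg h') (.single (.appFun h))
  | appArg h ih =>
    cases htu with
    | here h' =>
      obtain ⟨U, v, a⟩ := h'
      -- A step in the argument has one residual per occurrence of the bound variable, possibly
      -- none.
      refine hclose _ _ _ (.here (.mk _ _ _))
        (reflTransGen_subst (isCompatible_somewhere K) hK.somewhere v fun x => ?_)
      cases x with
      | zero => exact .single h
      | succ x => exact .refl
    | appFun h' => exact hclose _ _ _ (.appFun h') (.single (.appArg h))
    | appArg h' => exact hJ.appArg _ (ih h')
  | piDom h ih =>
    cases htu with
    | here h => cases h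
    | piDom h' => exact hJ.piDom _ (ih h')
    | piBody h' => exact hclose _ _ _ (.piBody h') (.single (.piDom h))
  | piBody h ih =>
    cases htu with
    | here h => cases h
    | piDom h' => exact hclose _ _ _ (.piDom h') (.single (.piBody h))
    | piBody h' => exact hJ.piBody _ (ih h')

theorem not_ruleInstance_lam {arity : F → ℕ} {R : Set (Rule F)} (hR : IsRuleSet arity R)
    (A u s : Term F) : ¬ RuleInstance R (.lam A u) s := by
  intro h
  generalize hw : Term.lam A u = w at h
  obtain ⟨ρ, hρ, σ⟩ := h
  exact (hR ρ hρ).algebraic.isFirstOrder.subst_ne_lam (hR ρ hρ).not_var σ A u hw.symm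

theorem beta_locally_confluent {t s u : Term F} (hts : Beta t s) (htu : Beta t u) :
    ∃ w, ReflTransGen Beta s w ∧ ReflTransGen Beta u w := by
  have hc := isCompatible_somewhere (BetaRedex (F := F))
  have hs := (isSubstStable_betaRedex (F := F)).somewhere
  refine peak_of_root (J := fun s u => ∃ w, ReflTransGen Beta s w ∧ ReflTransGen Beta u w)
    isSubstStable_betaRedex (fun A u s h => by cases h)
    (hc.reflTransGen.join hc.reflTransGen) ?_ (fun s u w h k => ⟨w, .single h, k⟩) hts htu
  rintro _ _ u ⟨U, v, a⟩ h
  cases h with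
  | here h => cases h; exact ⟨_, .refl, .refl⟩
  | appFun h =>
    cases h with
    | here h => cases h
    | lamDom h => exact ⟨_, .refl, .single (.here (.mk _ _ _))⟩
    | lamBody h => exact ⟨_, .single (hs h _), .single (.here (.mk _ _ _))⟩
  | appArg h =>
    refine ⟨_, reflTransGen_subst hc hs v fun x => ?_, .single (.here (.mk _ _ _))⟩
    cases x with
    | zero => exact .single h
    | succ x => exact .refl

/-- `β` and the rewrite relation of a set of rules locally commute, up to joinability. -/
theorem rew_beta_joinable {arity : F → ℕ} {R : Set (Rule F)} (hR : IsRuleSet arity R)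
    {t s u : Term F} (hts : Rew R t s) (htu : Beta t u) :
    ∃ w, ReflTransGen (fun a b => Beta a b ∨ Rew R a b) s w ∧
      ReflTransGen (fun a b => Beta a b ∨ Rew R a b) u w := by
  have hβ := isCompatible_somewhere (BetaRedex (F := F))
  have hρ := isCompatible_somewhere (RuleInstance R)
  have hc : IsCompatible (fun a b => Beta a b ∨ Rew R a b) :=
    { lamDom := fun u => Or.imp (hβ.lamDom u) (hρ.lamDom u)
      lamBody := fun A _ _ => Or.imp (hβ.lamBody A) (hρ.lamBody A)
      appFun := fun u => Or.imp (hβ.appFun u) (hρ.appFun u)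
      appArg := fun t _ _ => Or.imp (hβ.appArg t) (hρ.appArg t)
      piDom := fun u => Or.imp (hβ.piDom u) (hρ.piDom u)
      piBody := fun A _ _ => Or.imp (hβ.piBody A) (hρ.piBody A) }
  refine peak_of_root (J := fun s u => ∃ w,
      ReflTransGen (fun a b => Beta a b ∨ Rew R a b) s w ∧
        ReflTransGen (fun a b => Beta a b ∨ Rew R a b) u w)
    (isSubstStable_ruleInstance R) (not_ruleInstance_lam hR)
    (hc.reflTransGen.join hc.reflTransGen) ?_
    (fun s u w h k => ⟨w, .single (.inl h), ReflTransGen.mono (fun _ _ => .inr) _ _ k⟩) hts htu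
  rintro _ _ u ⟨ρ, hρ, σ⟩ h
  obtain ⟨x, a, -, ha, hr, -⟩ :=
    beta_subst_of_isFirstOrder (hR ρ hρ).algebraic.isFirstOrder h
  exact ⟨_, ReflTransGen.mono (fun _ _ => .inl) _ _
      (reflTransGen_subst_update hβ isSubstStable_betaRedex.somewhere ρ.rhs ha),
    (ReflTransGen.mono (fun _ _ => .inl) _ _ hr).tail (.inr (.here (.mk ρ hρ _)))⟩

/-- A step of a linear set of equations can be postponed after a `β`-step. -/
theorem rew_beta_commute {arity : F → ℕ} {E : Set (Rule F)} (hE : IsEquationSet arity E)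
    (hlin : ∀ ρ ∈ E, ρ.IsLinear) {t s u : Term F} (hts : Rew E t s) (htu : Beta t u) :
    ∃ w, Beta s w ∧ Sim E u w := by
  have hβ := isCompatible_somewhere (BetaRedex (F := F))
  refine peak_of_root (J := fun s u => ∃ w, Beta s w ∧ Sim E u w)
    (isSubstStable_ruleInstance E) (not_ruleInstance_lam hE.1)
    (hβ.join (isCompatible_somewhere (RuleInstance E)).reflTransGen) ?_
    (fun s u w h k => ⟨w, h, k⟩) hts htu
  rintro _ _ u ⟨ρ, hρ, σ⟩ h
  obtain ⟨x, a, hx, ha, -, hu⟩ :=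
    beta_subst_of_isFirstOrder (hE.1 ρ hρ).algebraic.isFirstOrder h
  obtain rfl := hu (hlin ρ hρ).1
  -- The reversed equation is also a rule, so `x` is not erased; with right-linearity it occurs
  -- exactly once.
  have hxr : 0 < ρ.rhs.occ x := (hE.1 _ ((hE.2 ρ.lhs ρ.rhs).1 hρ)).fv_subset hx
  exact ⟨_, subst_update_of_occ_eq_one hβ isSubstStable_betaRedex.somewhere ρ.rhs ha
      (le_antisymm ((hlin ρ hρ).2 x) hxr),
    .single (.here (.mk ρ hρ _))⟩

/-! ### Reduction modulo -/

theorem rew_symm {arity : F → ℕ} {E : Set (Rule F)} (hE : IsEquationSet arity E) {t u : Term F}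
    (h : Rew E t u) : Rew E u t := by
  induction h with
  | here h =>
    obtain ⟨ρ, hρ, σ⟩ := h
    exact .here (.mk ⟨ρ.rhs, ρ.lhs⟩ ((hE.2 _ _).1 hρ) σ)
  | lamDom _ ih => exact .lamDom ih
  | lamBody _ ih => exact .lamBody ih
  | appFun _ ih => exact .appFun ih
  | appArg _ ih => exact .appArg ih
  | piDom _ ih => exact .piDom ih
  | piBody _ ih => exact .piBody ih

theorem sim_symm {arity : F → ℕ} {E : Set (Rule F)} (hE : IsEquationSet arity E) {t u : Term F}
    (h : Sim E t u) : Sim E u t :=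
  have : Std.Symm (Rew E) := ⟨fun _ _ => rew_symm hE⟩
  ReflTransGen.stdSymm.symm _ _ h

theorem sim_beta_commute {arity : F → ℕ} {E : Set (Rule F)} (hE : IsEquationSet arity E)
    (hlin : ∀ ρ ∈ E, ρ.IsLinear) {t s u : Term F} (hts : Sim E t s) (htu : Beta t u) :
    ∃ w, Beta s w ∧ Sim E u w := by
  induction hts with
  | refl => exact ⟨u, htu, .refl⟩
  | tail _ h ih =>
    obtain ⟨w, hw, huw⟩ := ih
    obtain ⟨w', hw', hww'⟩ := rew_beta_commute hE hlin h hw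
    exact ⟨w', hw', huw.trans hww'⟩

/-- `▷` is strongly coherent with `∼`. -/
theorem sim_red_commute {arity : F → ℕ} {R E : Set (Rule F)} (hE : IsEquationSet arity E)
    (hlin : ∀ ρ ∈ E, ρ.IsLinear) {t s u : Term F} (hts : Sim E t s) (htu : Red R E t u) :
    ∃ w, Red R E s w ∧ Sim E u w := by
  rcases htu with h | ⟨t', ht', h⟩
  · obtain ⟨w, hw, huw⟩ := sim_beta_commute hE hlin hts h
    exact ⟨w, .inl hw, huw⟩
  · exact ⟨u, .inr ⟨t', (sim_symm hE hts).trans ht', h⟩, .refl⟩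

theorem Red.of_rew {R : Set (Rule F)} (E : Set (Rule F)) {t u : Term F} (h : Rew R t u) :
    Red R E t u :=
  .inr ⟨t, .refl, h⟩

theorem reach_sim {R E : Set (Rule F)} {X : Set (Term F)} {t u : Term F} (ht : t ∈ Reach R E X)
    (h : Sim E t u) : u ∈ Reach R E X :=
  let ⟨s, hs, hst⟩ := ht
  ⟨s, hs, hst.trans (ReflTransGen.mono (fun _ _ h => .inr (.inr h)) _ _ h)⟩

theorem reach_red {R E : Set (Rule F)} {X : Set (Term F)} {t u : Term F} (ht : t ∈ Reach R E X)
    (h : Red R E t u) : u ∈ Reach R E X := by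
  rcases h with h | ⟨s, hs, h⟩
  · obtain ⟨t₀, ht₀, h₀⟩ := ht
    exact ⟨t₀, ht₀, h₀.tail (.inl h)⟩
  · obtain ⟨t₀, ht₀, h₀⟩ := reach_sim ht hs
    exact ⟨t₀, ht₀, h₀.tail (.inr (.inl h))⟩

/-! ### Termination and Newman's lemma modulo an equivalence -/

section Abstract

variable {T : Type u} {r sim : T → T → Prop}

/-- Several steps of a relation that is strongly coherent with `sim`. -/
theorem reflTransGen_commute (hcom : ∀ {t s u}, sim t s → r t u → ∃ w, r s w ∧ sim u w)
    {t s u : T} (hts : sim t s) (h : ReflTransGen r t u) :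
    ∃ w, ReflTransGen r s w ∧ sim u w := by
  induction h with
  | refl => exact ⟨s, .refl, hts⟩
  | tail _ h ih =>
    obtain ⟨w, hw, huw⟩ := ih
    obtain ⟨w', hw', huw'⟩ := hcom huw h
    exact ⟨w', hw.tail hw', huw'⟩

/-- A step from `s` is matched by a step from `t` to a related element, so descending sequences from
`s` can be replayed from `t`. -/
theorem acc_of_sim (hcom : ∀ {t s u}, sim t s → r t u → ∃ w, r s w ∧ sim u w)
    (hsymm : ∀ {t s}, sim t s → sim s t) {t : T} (ht : Acc (fun a b => r b a) t) :
    ∀ {s}, sim t s → Acc (fun a b => r b a) s := by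
  induction ht with
  | intro t _ ih =>
    intro s hts
    refine ⟨_, fun u hu => ?_⟩
    obtain ⟨w, hw, huw⟩ := hcom (hsymm hts) hu
    exact ih w hw (hsymm huw)

/-- No accessible element reduces to an element related to it. -/
theorem not_sim_of_transGen (hcom : ∀ {t s u}, sim t s → r t u → ∃ w, r s w ∧ sim u w)
    {t : T} (ht : Acc (fun a b => r b a) t) :
    ∀ {u v}, r t u → ReflTransGen r u v → ¬ sim t v := by
  induction ht with
  | intro t _ ih =>
    intro u v hu huv htv
    -- Replaying the first step at the end of the cycle gives a nonempty cycle modulo `sim` starting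
    -- from `u`.
    obtain ⟨u', hu', huu'⟩ := hcom htv hu
    rcases ReflTransGen.cases_head huv with rfl | ⟨u₁, hu₁, h₁⟩
    · exact ih u hu hu' .refl huu'
    · exact ih u hu hu₁ (h₁.tail hu') huu'

/-- Newman's lemma for a terminating relation that is strongly coherent with an equivalence: local
confluence may use confluence on classes below. -/
theorem joinableModulo_of_acc (hcom : ∀ {t s u}, sim t s → r t u → ∃ w, r s w ∧ sim u w)
    (hsymm : ∀ {t s}, sim t s → sim s t) (htrans : ∀ {t s u}, sim t s → sim s u → sim t u)
    {Y : Set T} (hY : ∀ {t u}, t ∈ Y → r t u → u ∈ Y)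
    (hloc : ∀ t ∈ Y, (∀ w, r t w → ∀ w' u v, sim w w' → ReflTransGen r w u →
      ReflTransGen r w' v → JoinableModulo sim r u v) →
      ∀ u v, r t u → r t v → JoinableModulo sim r u v)
    {t : T} (ht : Acc (fun a b => r b a) t) (htY : t ∈ Y) :
    ∀ t' u v, sim t t' → ReflTransGen r t u → ReflTransGen r t' v →
      JoinableModulo sim r u v := by
  induction ht with
  | intro t _ ih =>
    intro t' u v htt' htu htv'
    -- Both reductions can be made to start from `t` itself.
    obtain ⟨v₀, htv, hv⟩ := reflTransGen_commute hcom (hsymm htt') htv'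
    suffices JoinableModulo sim r u v₀ by
      obtain ⟨a, b, hua, hab, hvb⟩ := this
      obtain ⟨c, hvc, hbc⟩ := reflTransGen_commute hcom (hsymm hv) hvb
      exact ⟨a, c, hua, htrans hab hbc, hvc⟩
    -- Reflexivity of `sim` is not assumed: it is recovered at `t` and carried along reductions.
    have hrefl : ∀ {x}, sim t t → ReflTransGen r t x → sim x x := fun h₀ h =>
      have ⟨_, _, h'⟩ := reflTransGen_commute hcom h₀ h
      htrans h' (hsymm h')
    have htt : sim t t := htrans htt' (hsymm htt')
    rcases ReflTransGen.cases_head htu with rfl | ⟨u₁, hu₁, hu₁u⟩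
    · exact ⟨v₀, v₀, htv, hrefl htt htv, .refl⟩
    rcases ReflTransGen.cases_head htv with rfl | ⟨v₁, hv₁, hv₁v⟩
    · exact ⟨u, u, .refl, hrefl htt htu, htu⟩
    have ih' := fun w hw => ih w hw (hY htY hw)
    obtain ⟨a, b, hua, hab, hvb⟩ := hloc t htY ih' u₁ v₁ hu₁ hv₁
    -- Newman's diagram: induction at `u₁`, then at `v₁`, with each reduction carried across `sim`
    -- before the next tile is glued.
    obtain ⟨c, d, huc, hcd, had⟩ := ih' u₁ hu₁ u₁ u a (hrefl htt (.single hu₁)) hu₁u hua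
    obtain ⟨d', hbd', hdd'⟩ := reflTransGen_commute hcom hab had
    obtain ⟨e, f, hef, hsef, hvf⟩ :=
      ih' v₁ hv₁ v₁ d' v₀ (hrefl htt (.single hv₁)) (hvb.trans hbd') hv₁v
    obtain ⟨c', hcc', hec'⟩ := reflTransGen_commute hcom (hsymm (htrans hcd hdd')) hef
    exact ⟨c', f, huc.trans hcc', htrans (hsymm hec') hsef, hvf⟩

end Abstract

/-- Two `R`-steps from elements of the same `∼`-class are joinable, if confluence on classes holds
below that class. -/
theorem rew_rew_joinable {arity : F → ℕ} {R E : Set (Rule F)} (hE : IsEquationSet arity E)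
    (hlin : ∀ ρ ∈ E, ρ.IsLinear) {Y : Set (Term F)}
    (hY : ∀ {t u}, t ∈ Y → Sim E t u → u ∈ Y)
    (hacc : ∀ t ∈ Y, Acc (fun a b => Red R E b a) t)
    (hconf : LocallyConfluentModuloOn Y (Sim E) (Rew R))
    (hcoh : LocallyCoherentModuloOn Y (Rew E) (Rew R)) {t : Term F} (ht : t ∈ Y)
    (ih : ∀ w, Red R E t w → ∀ w' u v, Sim E w w' → ReflTransGen (Red R E) w u →
      ReflTransGen (Red R E) w' v → JoinableModulo (Sim E) (Red R E) u v)
    {s s' u v : Term F} (hts : Sim E t s) (hss' : Sim E s s') (hsu : Rew R s u)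
    (hsv : Rew R s' v) : JoinableModulo (Sim E) (Red R E) u v := by
  have hcom : ∀ {t s u}, Sim E t s → Red R E t u → ∃ w, Red R E s w ∧ Sim E u w :=
    sim_red_commute hE hlin
  have hsymm : ∀ {t s}, Sim E t s → Sim E s t := sim_symm hE
  have hmono : ∀ {a b}, ReflTransGen (Rew R) a b → ReflTransGen (Red R E) a b :=
    fun h => ReflTransGen.mono (fun _ _ => Red.of_rew E) _ _ h
  induction hss' using ReflTransGen.head_induction_on generalizing u with
  | refl =>
    obtain ⟨a, b, hua, hab, hvb⟩ := hconf _ (hY ht hts) u v hsu hsv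
    exact ⟨a, b, hmono hua, hab, hmono hvb⟩
  | @head s s₁ hs _ ihs =>
    obtain ⟨a, b, hsa, hab, hub⟩ := hcoh s (hY ht hts) s₁ u (rew_symm hE hs) hsu
    -- If `s₁` made no step, then `s` would reduce through `u` to a member of its own class.
    rcases ReflTransGen.cases_head hsa with rfl | ⟨w, hw, hwa⟩
    · exact absurd ((ReflTransGen.single hs).trans hab)
        (not_sim_of_transGen hcom (hacc s (hY ht hts)) (.of_rew E hsu) (hmono hub))
    -- The shorter equational path joins `w` with `v`; since `t ▷ w`, confluence below `t` joins the
    -- two reductions of `w`.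
    · obtain ⟨c, d, hwc, hcd, hvd⟩ := ihs (hts.tail hs) hw
      obtain ⟨e, f, hae, hef, hcf⟩ := ih w (.inr ⟨s₁, hts.tail hs, hw⟩) w a c .refl (hmono hwa) hwc
      obtain ⟨g, hbg, heg⟩ := reflTransGen_commute hcom hab hae
      obtain ⟨k, hdk, hfk⟩ := reflTransGen_commute hcom hcd hcf
      exact ⟨g, k, (hmono hub).trans hbg, (hsymm heg).trans (hef.trans hfk), hvd.trans hdk⟩

/-- A `β`-step and a step of `∼R` from the same term are joinable. -/
theorem beta_simRew_joinable {arity : F → ℕ} {R E : Set (Rule F)} (hR : IsRuleSet arity R)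
    (hE : IsEquationSet arity E) (hlin : ∀ ρ ∈ E, ρ.IsLinear) {t s u v : Term F} (hu : Beta t u)
    (hs : Sim E t s) (hv : Rew R s v) : JoinableModulo (Sim E) (Red R E) u v := by
  -- Moving the `β`-step to `s` leaves a plain peak of `β` and `R`; its join is then carried back
  -- from `u'` to `u`.
  obtain ⟨u', hu', huu'⟩ := sim_beta_commute hE hlin hs hu
  obtain ⟨w, hvw, huw⟩ := rew_beta_joinable hR hv hu'
  have hmono : ∀ {a b}, ReflTransGen (fun a b => Beta a b ∨ Rew R a b) a b →
      ReflTransGen (Red R E) a b :=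
    fun h => ReflTransGen.mono (fun _ _ => Or.imp_right fun h => ⟨_, .refl, h⟩) _ _ h
  obtain ⟨w', huw', hww'⟩ := reflTransGen_commute (sim_red_commute (R := R) hE hlin)
    (sim_symm hE huu') (hmono huw)
  exact ⟨w', w, huw', sim_symm hE hww', hmono hvw⟩

theorem JoinableModulo.symm {T : Type u} {sim r : T → T → Prop}
    (hsymm : ∀ {t s}, sim t s → sim s t) {u v : T} (h : JoinableModulo sim r u v) :
    JoinableModulo sim r v u :=
  let ⟨a, b, hua, hab, hvb⟩ := h
  ⟨b, a, hvb, hsymm hab, hua⟩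

end CAC

theorem mainTheorem5 {F : Type u} (arity : F → ℕ) (R E : Set (CAC.Rule F))
    (hR : CAC.IsRuleSet arity R) (hE : CAC.IsEquationSet arity E)
    (hlin : ∀ ρ ∈ E, ρ.IsLinear) (X : Set (CAC.Term F))
    (hSN : CAC.StronglyNormalizingOn X (CAC.Red R E))
    (hconf : CAC.LocallyConfluentModuloOn (CAC.Reach R E X) (CAC.Sim E) (CAC.Rew R))
    (hcoh : CAC.LocallyCoherentModuloOn (CAC.Reach R E X) (CAC.Rew E) (CAC.Rew R)) :
    CAC.ConfluentOnClassesOn X (CAC.Sim E) (CAC.Red R E) := by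
  have hcom : ∀ {t s u}, CAC.Sim E t s → CAC.Red R E t u →
      ∃ w, CAC.Red R E s w ∧ CAC.Sim E u w :=
    CAC.sim_red_commute hE hlin
  have hsymm : ∀ {t s}, CAC.Sim E t s → CAC.Sim E s t := CAC.sim_symm hE
  have hacc : ∀ t ∈ CAC.Reach R E X, Acc (fun a b => CAC.Red R E b a) t := by
    rintro t ⟨s, hs, hst⟩
    -- `β`- and `R`-steps are `▷`-steps; `E`-steps stay in the same class.
    induction hst with
    | refl => exact hSN s hs
    | tail _ h ih =>
      rcases h with h | h | h
      · exact ih.inv (.inl h)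
      · exact ih.inv (.of_rew E h)
      · exact CAC.acc_of_sim hcom hsymm ih (.single h)
  intro t ht
  have htY : t ∈ CAC.Reach R E X := ⟨t, ht, .refl⟩
  refine CAC.joinableModulo_of_acc (sim := CAC.Sim E) (r := CAC.Red R E) hcom hsymm .trans
    CAC.reach_red ?_ (hacc t htY) htY
  rintro t htY ih u v (hu | ⟨s, hs, hu⟩) (hv | ⟨s', hs', hv⟩)
  · obtain ⟨w, huw, hvw⟩ := CAC.beta_locally_confluent hu hv
    exact ⟨w, w, Relation.ReflTransGen.mono (fun _ _ => .inl) _ _ huw, .refl,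
      Relation.ReflTransGen.mono (fun _ _ => .inl) _ _ hvw⟩
  · exact CAC.beta_simRew_joinable hR hE hlin hu hs' hv
  · exact (CAC.beta_simRew_joinable hR hE hlin hv hs hu).symm hsymm
  · exact CAC.rew_rew_joinable hE hlin CAC.reach_sim hacc hconf hcoh htY ih hs
      ((hsymm hs).trans hs') hu hv
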